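/- A parametric timed automaton $\mathcal A=(\Sigma,Q,T,q_0,B)$ with finite clock set $X$ and parameter set $P$ has a finite alphabet $\Sigma$, a finite set $Q$ of control states, an initial state $q_0\in Q$, a set $B\subseteq Q$ of Büchi states, and a finite set $T$ of transitions $q\xrightarrow{\gamma,a,S}q'$, where $a\in\Sigma$, $S\subseteq X$ is the set of clocks that are reset, and the guard $\gamma$ is a (possibly empty) Boolean combination of comparisons $x<c$, $x=c$, $x<p$, $x=p$ with $x\in X$, $c\in\mathbb N$, $p\in P$. It is a non-resetting test automaton (nrtTA) if no transition resets a clock that occurs in its guard. Let $C$ be the largest constant $c$ occurring in the guards of $\mathcal A$ ($C=0$ if there is none). A timed word $(\pi,\tau)$ consists of letters $\pi(i)\in\Sigma$ and timestamps $\tau(i)\ge 0$, $i\ge 1$, with $\tau(i)<\tau(i+1)$; put $\tau(0)=0$. A parametric run over $(\pi,\tau)$ with parameter evaluation $\mathcal I:P\to\mathbb R$ is an infinite sequence of configurations $(q_i,v_i)_{i\ge 0}$, with states $q_i \in Q$ starting at the initial state and clock valuations $v_i:X\to\mathbb R_{\ge 0}$, $v_0=0$, such that for every $i\ge 1$ there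 is a transition in $T$ from $q_{i-1}$ to $q_i$ with letter $\pi(i)$, some guard $\gamma_i$ and some reset set $S_i$, for which $v_{i-1}+\tau(i)-\tau(i-1)$ satisfies $\gamma_i$ under $\mathcal I$, $v_i(x)=0$ for $x\in S_i$, and $v_i(x)=v_{i-1}(x)+\tau(i)-\tau(i-1)$ for $x\notin S_i$. (No acceptance condition is imposed on a run.) Theorem. Let $\mathcal A$ be a parametric nrtTA with exactly two clocks and exactly one parameter $\mu$. There is a real number $\Xi>2C$ such that, for every real $\bar\mu>2C$, if $\mathcal A$ has a parametric run over some timed word with $\mathcal I(\mu)=\bar\mu$, then $\mathcal A$ has a parametric run over some timed word with $\mathcal I(\mu)=\Xi$. Moreover, every real $\Xi>1+C(1+|Q|)$ satisfies $\Xi>2C$ and has this property. -/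

import Mathlib

/-- Clock constraints over the clocks `X` and the parameters `P`: comparisons `x < c`, `x = c` of a
clock with a natural constant, comparisons `x < p`, `x = p` of a clock with a parameter, the trivial
constraint (a transition without guard), negations and conjunctions. -/
inductive Guard (X P : Type*) where
  | tt : Guard X P
  | ltConst : X → ℕ → Guard X P
  | eqConst : X → ℕ → Guard X P
  | ltParam : X → P → Guard X P
  | eqParam : X → P → Guard X P
  | neg : Guard X P → Guard X P
  | conj : Guard X P → Guard X P → Guard X P

namespace Guard

variable {X P : Type*}

/-- `g.Sat I v`: the clock valuation `v` satisfies `g` under the parameter evaluation `I`. -/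
def Sat (I : P → ℝ) (v : X → ℝ) : Guard X P → Prop
  | tt => True
  | ltConst x c => v x < (c : ℝ)
  | eqConst x c => v x = (c : ℝ)
  | ltParam x p => v x < I p
  | eqParam x p => v x = I p
  | neg g => ¬ Sat I v g
  | conj g h => Sat I v g ∧ Sat I v h

/-- The set of clocks that occur in a constraint. -/
def clocks : Guard X P → Set X
  | tt => ∅
  | ltConst x _ => {x}
  | eqConst x _ => {x}
  | ltParam x _ => {x}
  | eqParam x _ => {x}
  | neg g => clocks g
  | conj g h => clocks g ∪ clocks h

/-- The largest natural constant that occurs in a constraint (`0` if there is none). -/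
def maxConst : Guard X P → ℕ
  | tt => 0
  | ltConst _ c => c
  | eqConst _ c => c
  | ltParam _ _ => 0
  | eqParam _ _ => 0
  | neg g => maxConst g
  | conj g h => max (maxConst g) (maxConst h)

end Guard

/-- A transition `src --(guard, letter, resets)--> tgt`. -/
structure Transition (S Q X P : Type*) where
  src : Q
  tgt : Q
  guard : Guard X P
  letter : S
  resets : Set X

/-- A parametric timed automaton over the alphabet `S` with control states `Q`, clocks `X` and
parameters `P`: a finite set of transitions, an initial state and a set of Büchi states. -/
structure ParamTA (S Q X P : Type*) where
  trans : Finset (Transition S Q X P)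
  init : Q
  buchi : Set Q

/-- A timed ω-word. The positions are `1, 2, 3, …`: `letter i` and `time i` are the letter and the
timestamp at position `i ≥ 1`. The value `letter 0` is irrelevant, and `time 0 = 0` by convention.
Timestamps are nonnegative and strictly increasing over the positions `i ≥ 1` (so `time 1 = 0` is
allowed). -/
structure TimedWord (S : Type*) where
  letter : ℕ → S
  time : ℕ → ℝ
  time_zero : time 0 = 0
  time_one_nonneg : 0 ≤ time 1
  time_lt : ∀ i, 1 ≤ i → time i < time (i + 1)

namespace ParamTA

variable {S Q X P : Type*}

/-- The maximum constant that occurs in the guards of `A` (`0` if there is none). -/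
def maxConst (A : ParamTA S Q X P) : ℕ :=
  A.trans.sup fun t => t.guard.maxConst

/-- No transition tests and resets the same clock. -/
def IsNonResettingTest (A : ParamTA S Q X P) : Prop :=
  ∀ t ∈ A.trans, t.guard.clocks ∩ t.resets = ∅

/-- The infinite sequence of configurations `(q i, v i)`, `i = 0, 1, 2, …`, is a parametric run of
`A` over the timed word `w` with parameter evaluation `I`. (All the `v i` are then nonnegative.) -/
structure IsRun (A : ParamTA S Q X P) (I : P → ℝ) (w : TimedWord S)
    (q : ℕ → Q) (v : ℕ → X → ℝ) : Prop where
  state_zero : q 0 = A.init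
  val_zero : ∀ x, v 0 x = 0
  step : ∀ i, ∃ t ∈ A.trans,
    t.src = q i ∧ t.tgt = q (i + 1) ∧ t.letter = w.letter (i + 1) ∧
    t.guard.Sat I (fun x => v i x + (w.time (i + 1) - w.time i)) ∧
    (∀ x ∈ t.resets, v (i + 1) x = 0) ∧
    (∀ x, x ∉ t.resets → v (i + 1) x = v i x + (w.time (i + 1) - w.time i))

/-- `A` has a parametric run, over some timed word, with parameter evaluation `I`. -/
def HasRun (A : ParamTA S Q X P) (I : P → ℝ) : Prop :=
  ∃ (w : TimedWord S) (q : ℕ → Q) (v : ℕ → X → ℝ), A.IsRun I w q v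

end ParamTA

/-!
A run for the parameter value `μ > 2C` is imitated by a run for the parameter value
`Ξ > 1 + C(1 + |Q|)`. Only the zone of a clock value matters to the guards: its exact value up
to `C`, strictly between `C` and the parameter, equal to the parameter, or above it. As a clock that
is reset is not tested by the same transition, the imitating run may wait before a reset without
being noticed as far as the reset clock is concerned, and while both clocks exceed `C` it may
choose its delays almost freely.

What has to be preserved exactly is a clock value up to `C`, a distance up to `C` from the
parameter when the other clock is at most `C`, and a difference up to `C` between the clocks when
the one ahead is going to reach the parameter. `TwoClockTrace.Rel` is a simulation relation that
records just this, and `TwoClockTrace.Rel.reaches` says that every related configuration moves on to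
a related one.

The relation cannot be maintained one step at a time. If `y` stays between `C` and `μ` while
`x` is reset over and over, the run for `μ` may spend more time there than `Ξ` permits. The imitating
run then jumps: it selects a later reset of `x` and goes there on a short path that visits no source
state of a reset twice and spends hardly more than `C` between two resets
(`TwoClockTrace.reaches_reset_source`). So it gets there while `y'` is still at distance more than
`C` from `Ξ`, and waits until the distance is the right one. The selected reset is one where `y` is
itself close to `μ`; if there is none, it is the last one, or, if there are infinitely many, one
after which `y` grows by so little that the rest can be copied
(`TwoClockTrace.reaches_of_reset_mid`). If `y` exceeds `C` before `x` does, one more stretch of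
length `C` precedes the first reset of `x`; then the state in which `y` passes `C` is used in the
pigeonhole argument as well (`TwoClockTrace.reaches_of_not_noReset`), which gives the bound
`1 + C(1 + |Q|)`.
-/

/-! ### Traces of two clocks and moves that imitate them -/

/-- `SameZone C μ Ξ z z'`: the clock value `z`, read with parameter value `μ`, and the clock value
`z'`, read with parameter value `Ξ`, cannot be told apart by a test whose constants are at
most `C`. Values strictly between `C` and the parameter are all identified. -/
inductive SameZone (C μ Ξ z z' : ℝ) : Prop
  | low : z' = z → z ≤ C → SameZone C μ Ξ z z'
  | mid : C < z → z < μ → C < z' → z' < Ξ → SameZone C μ Ξ z z'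
  | param : z = μ → z' = Ξ → SameZone C μ Ξ z z'
  | high : μ < z → Ξ < z' → SameZone C μ Ξ z z'

/-- The part of an infinite run that matters for the clocks `x` and `y`: the control states, the
clock values on entering them, the positive delay `δ i` spent in the `i`-th one, and which clocks
the transition taken after that delay resets. -/
structure TwoClockTrace (Q : Type*) where
  q : ℕ → Q
  x : ℕ → ℝ
  y : ℕ → ℝ
  δ : ℕ → ℝ
  rx : ℕ → Prop
  ry : ℕ → Prop
  delay_pos : ∀ i, 0 < δ i
  x_nonneg : ∀ i, 0 ≤ x i
  y_nonneg : ∀ i, 0 ≤ y i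
  x_reset : ∀ i, rx i → x (i + 1) = 0
  x_keep : ∀ i, ¬ rx i → x (i + 1) = x i + δ i
  y_reset : ∀ i, ry i → y (i + 1) = 0
  y_keep : ∀ i, ¬ ry i → y (i + 1) = y i + δ i

namespace TwoClockTrace

variable {Q : Type*}

/-- The trace with the roles of the two clocks exchanged. -/
def swap (T : TwoClockTrace Q) : TwoClockTrace Q where
  q := T.q
  x := T.y
  y := T.x
  δ := T.δ
  rx := T.ry
  ry := T.rx
  delay_pos := T.delay_pos
  x_nonneg := T.y_nonneg
  y_nonneg := T.x_nonneg
  x_reset := T.y_reset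
  x_keep := T.y_keep
  y_reset := T.x_reset
  y_keep := T.x_keep

/-- One step of the imitating run, from a configuration `(state, x, y)` to another: it takes some
transition of the trace after a positive delay `d`, and every clock that this transition does not
reset (only such a clock can be tested) is in the same zone as in the trace. The transition may be
any one of the trace that leaves the present state, which permits cutting loops. -/
def Move (C μ Ξ : ℝ) (T : TwoClockTrace Q) (c c' : Q × ℝ × ℝ) : Prop :=
  ∃ i d, 0 < d ∧ c.1 = T.q i ∧ c'.1 = T.q (i + 1) ∧
    (T.rx i → c'.2.1 = 0) ∧
    (¬ T.rx i → SameZone C μ Ξ (T.x i + T.δ i) (c.2.1 + d) ∧ c'.2.1 = c.2.1 + d) ∧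
    (T.ry i → c'.2.2 = 0) ∧
    (¬ T.ry i → SameZone C μ Ξ (T.y i + T.δ i) (c.2.2 + d) ∧ c'.2.2 = c.2.2 + d)

/-- From step `i` through step `k`, the clock `y` is not reset and stays below `μ`. -/
def Stays (μ : ℝ) (T : TwoClockTrace Q) (i k : ℕ) : Prop :=
  ∀ j, i ≤ j → j ≤ k → ¬ T.ry j ∧ T.y j + T.δ j < μ

/-- From step `i` on, as long as `y` is not reset and stays below `μ`, the clock `x` is not reset
(unless `y` is reset with it). -/
def NoReset (μ : ℝ) (T : TwoClockTrace Q) (i : ℕ) : Prop :=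
  ∀ k, i ≤ k → Stays μ T i k → ¬ T.rx k

/-- The simulation relation between the clock values of the trace on entering its `i`-th state and
the clock values `x'`, `y'` of the imitating run in that state, for the orientation in which `y` is
ahead of `x` if they exceed `C`.

* `low`: both clocks are at most `C` and copied exactly.
* `close`: `y'` is at distance at most `C + 1/4 - x'` from `Ξ`. Either `y` has the same distance
  from `μ`, or `x` is not reset alone before `y` reaches `μ` or is reset, and exceeds `C` before `y`
  reaches the parameter, so that the time when this happens cannot be noticed.
* `linked`: the difference of the clocks is at most `C` and copied exactly. If `x` may be reset
  alone while `y` is below `μ`, then `y'` must not be much larger than `C`.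
* `high`: `y` has reached the parameter, so that only `x` matters.
* `forever`: `y` never reaches the parameter nor is reset, and there is room to copy the remaining
  delays exactly.

The constants `1/4` and `1/2` divide up the summand `1` of the bound `1 + C(1 + |Q|)`; they give
room for positive delays where the bound without that summand would be met exactly. -/
inductive Rel (C μ Ξ : ℝ) (T : TwoClockTrace Q) (i : ℕ) (x' y' : ℝ) : Prop
  | low : x' = T.x i → T.x i ≤ C → y' = T.y i → T.y i ≤ C → Rel C μ Ξ T i x' y'
  | close : T.x i < T.y i → T.y i < μ → C < T.y i → y' < Ξ → x' + (Ξ - y') ≤ C + 1 / 4 →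
      (x' = T.x i ∧ T.x i ≤ C ∨ C < T.x i ∧ C < x') →
      (Ξ - y' = μ - T.y i ∨
        NoReset μ T i ∧ C < T.x i + (μ - T.y i) ∧ C < x' + (Ξ - y')) → Rel C μ Ξ T i x' y'
  | linked : T.x i ≤ T.y i → T.y i < μ → C < T.y i → y' < Ξ → y' - x' = T.y i - T.x i →
      T.y i - T.x i ≤ C →
      (x' = T.x i ∧ T.x i ≤ C ∨ C < T.x i ∧ C < x' ∧ x' < C + 1 / 2) →
      (NoReset μ T i ∨ y' < C + 1 / 2 ∧ C < T.x i) → Rel C μ Ξ T i x' y'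
  | high : μ ≤ T.y i → Ξ ≤ y' →
      (x' = T.x i ∧ T.x i ≤ C ∨ C < T.x i ∧ T.x i < μ ∧ C < x' ∧ x' < C + 1 / 2 ∨
        C < T.x i ∧ T.x i < μ ∧ Ξ - x' = μ - T.x i ∧ μ - T.x i ≤ C + 1 / 4 ∨
        μ ≤ T.x i ∧ Ξ ≤ x') → Rel C μ Ξ T i x' y'
  | forever : (∀ k, i ≤ k → ¬ T.ry k ∧ T.y k + T.δ k < μ ∧ y' + (T.y k - T.y i) < Ξ) →
      x' = T.x i → T.x i ≤ T.y i → T.x i ≤ y' → C < T.y i → C < y' → Rel C μ Ξ T i x' y'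

/-- From the configuration `c`, finitely many moves (at least one) lead to a configuration that is
related to some position of the trace, in one of the two orientations. -/
def Reaches (C μ Ξ : ℝ) (T : TwoClockTrace Q) (c : Q × ℝ × ℝ) : Prop :=
  ∃ j x' y', Relation.TransGen (Move C μ Ξ T) c (T.q j, x', y') ∧
    (Rel C μ Ξ T j x' y' ∨ Rel C μ Ξ T.swap j y' x')

variable {C μ Ξ : ℝ} {T : TwoClockTrace Q} {i : ℕ} {x' y' : ℝ}

theorem Move.swap {c c' : Q × ℝ × ℝ} (h : Move C μ Ξ T.swap c c') :
    Move C μ Ξ T (c.1, c.2.2, c.2.1) (c'.1, c'.2.2, c'.2.1) := by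
  obtain ⟨i, d, hd, h1, h2, h3, h4, h5, h6⟩ := h
  exact ⟨i, d, hd, h1, h2, h5, h6, h3, h4⟩

theorem Reaches.swap {p : Q} (h : Reaches C μ Ξ T.swap (p, y', x')) :
    Reaches C μ Ξ T (p, x', y') := by
  obtain ⟨j, a, b, h1, h2⟩ := h
  have := Relation.TransGen.lift (r := Move C μ Ξ T.swap) (p := Move C μ Ξ T)
    (fun c : Q × ℝ × ℝ => (c.1, c.2.2, c.2.1)) (fun _ _ h => h.swap) _ _ h1
  exact ⟨j, b, a, this, h2.symm⟩

theorem reaches_of_not_reset {d : ℝ} (hd : 0 < d) (hrx : ¬ T.rx i) (hry : ¬ T.ry i)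
    (hx : SameZone C μ Ξ (T.x i + T.δ i) (x' + d)) (hy : SameZone C μ Ξ (T.y i + T.δ i) (y' + d))
    (h : Rel C μ Ξ T (i + 1) (x' + d) (y' + d) ∨ Rel C μ Ξ T.swap (i + 1) (y' + d) (x' + d)) :
    Reaches C μ Ξ T (T.q i, x', y') :=
  ⟨i + 1, _, _, .single ⟨i, d, hd, rfl, rfl, by simp [hrx], by simp [hx], by simp [hry],
    by simp [hy]⟩, h⟩

theorem reaches_of_reset_x {d : ℝ} (hd : 0 < d) (hrx : T.rx i) (hry : ¬ T.ry i)
    (hy : SameZone C μ Ξ (T.y i + T.δ i) (y' + d))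
    (h : Rel C μ Ξ T (i + 1) 0 (y' + d) ∨ Rel C μ Ξ T.swap (i + 1) (y' + d) 0) :
    Reaches C μ Ξ T (T.q i, x', y') :=
  ⟨i + 1, _, _, .single ⟨i, d, hd, rfl, rfl, by simp, by simp [hrx], by simp [hry],
    by simp [hy]⟩, h⟩

theorem reaches_of_reset_y {d : ℝ} (hd : 0 < d) (hrx : ¬ T.rx i) (hry : T.ry i)
    (hx : SameZone C μ Ξ (T.x i + T.δ i) (x' + d))
    (h : Rel C μ Ξ T (i + 1) (x' + d) 0 ∨ Rel C μ Ξ T.swap (i + 1) 0 (x' + d)) :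
    Reaches C μ Ξ T (T.q i, x', y') :=
  ⟨i + 1, _, _, .single ⟨i, d, hd, rfl, rfl, by simp [hrx], by simp [hx], by simp,
    by simp [hry]⟩, h⟩

theorem reaches_of_reset_both (hC : 0 ≤ C) (hrx : T.rx i) (hry : T.ry i) :
    Reaches C μ Ξ T (T.q i, x', y') := by
  refine ⟨i + 1, 0, 0, .single ⟨i, 1, one_pos, rfl, rfl, by simp, by simp [hrx], by simp,
    by simp [hry]⟩, .inl ?_⟩
  have h1 := T.x_reset i hrx
  have h2 := T.y_reset i hry
  exact .low h1.symm (by linarith) h2.symm (by linarith)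

/-- A clock that reaches the parameter in the trace can be made to reach it in the imitating run
by the choice of the delay. -/
theorem exists_delay_high {z z' : ℝ} (hz : μ ≤ z) (h : z' < Ξ ∨ μ < z) :
    ∃ d, 0 < d ∧ Ξ ≤ z' + d ∧ SameZone C μ Ξ z (z' + d) := by
  rcases hz.eq_or_lt with rfl | hz
  · have h := h.resolve_right (lt_irrefl _)
    exact ⟨Ξ - z', by linarith, by linarith, .param rfl (by ring)⟩
  · have h1 := le_max_left (Ξ - z') 0
    have h2 := le_max_right (Ξ - z') 0
    exact ⟨max (Ξ - z') 0 + 1, by linarith, by linarith, .high hz (by linarith)⟩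

/-- Values at the same distance from their parameters are in the same zone if both exceed `C`. -/
theorem sameZone_of_sub_eq {z z' : ℝ} (h : Ξ - z' = μ - z) (hz : C < z) (hz' : C < z') :
    SameZone C μ Ξ z z' := by
  rcases lt_trichotomy z μ with h1 | h1 | h1
  · exact .mid hz h1 hz' (by linarith)
  · exact .param h1 (by linarith)
  · exact .high h1 (by linarith)

theorem NoReset.succ (h : NoReset μ T i) (h1 : ¬ T.ry i) (h2 : T.y i + T.δ i < μ) :
    NoReset μ T (i + 1) := by
  intro k hk hj
  refine h k (by omega) fun j hj1 hj2 => ?_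
  rcases hj1.eq_or_lt with rfl | hlt
  · exact ⟨h1, h2⟩
  · exact hj j hlt hj2

theorem NoReset.not_rx (h : NoReset μ T i) (h1 : ¬ T.ry i) (h2 : T.y i + T.δ i < μ) :
    ¬ T.rx i :=
  h i le_rfl fun j hj1 hj2 => by
    obtain rfl := le_antisymm hj1 hj2
    exact ⟨h1, h2⟩

theorem Stays.y_add_le {k : ℕ} (h : Stays μ T i k) (hik : i ≤ k) :
    T.y i + T.δ i ≤ T.y k + T.δ k := by
  induction k, hik using Nat.le_induction with
  | base => exact le_rfl
  | succ k hik ih =>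
    have h1 := ih fun j hj hjk => h j hj (by omega)
    have h2 := T.y_keep k (h k hik (by omega)).1
    have h3 := T.delay_pos (k + 1)
    linarith

/-! ### Cutting loops while `y` stays between `C` and the parameter -/

/-- The invariant of the imitating run between two resets of `x`, while the clock `y` stays between
`C` and the parameter: the difference `β = y' - x'` is fixed, and the part of a delay that `x`
spends above `C` is compressed, so that `y'` stays below the bound `B`. The condition on `β` makes
sure that `y'` exceeds `C` when `y` does, even if `x` is small. -/
structure StretchInv (C : ℝ) (T : TwoClockTrace Q) (β B : ℝ) (r : ℕ) (x' y' : ℝ) : Prop where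
  le : T.x r ≤ T.y r
  x_zone : x' = T.x r ∧ T.x r ≤ C ∨ C < T.x r ∧ C < x'
  diff : y' = β + x'
  beta : C ≤ β ∨ β = T.y r - T.x r
  lt : y' < B

theorem StretchInv.move {β B : ℝ} (h : StretchInv C T β B i x' y') (hβ : 0 ≤ β) (hβB : β + C < B)
    (hB : B ≤ Ξ) (hrx : ¬ T.rx i) (hry : ¬ T.ry i) (hCy : C < T.y i + T.δ i)
    (hyμ : T.y i + T.δ i < μ) :
    ∃ x'' y'', Move C μ Ξ T (T.q i, x', y') (T.q (i + 1), x'', y'') ∧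
      StretchInv C T β B (i + 1) x'' y'' := by
  obtain ⟨hle, hz, hdiff, hb, hlt⟩ := h
  have hδ := T.delay_pos i
  have hx0 := T.x_nonneg i
  have hxs := T.x_keep i hrx
  have hys := T.y_keep i hry
  have hb' : C ≤ β ∨ β = T.y (i + 1) - T.x (i + 1) := by
    rcases hb with hb | hb
    · exact .inl hb
    · exact .inr (by linarith)
  -- it is enough to find the delay
  suffices ∃ d, 0 < d ∧ SameZone C μ Ξ (T.x i + T.δ i) (x' + d) ∧ C < y' + d ∧ y' + d < B ∧
      (x' + d = T.x i + T.δ i ∧ T.x i + T.δ i ≤ C ∨ C < T.x i + T.δ i ∧ C < x' + d) by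
    obtain ⟨d, hd, h1, h2, h3, h4⟩ := this
    refine ⟨x' + d, y' + d, ⟨i, d, hd, rfl, rfl, by simp [hrx], by simp [h1], by simp [hry], ?_⟩,
      ⟨by linarith, by rw [hxs]; exact h4, by linarith, hb', h3⟩⟩
    exact fun _ => ⟨.mid hCy hyμ h2 (by simp only; linarith), rfl⟩
  by_cases hX : T.x i + T.δ i ≤ C
  · have hx' : x' = T.x i := by
      rcases hz with hz | hz
      · exact hz.1
      · linarith
    refine ⟨T.δ i, hδ, .low (by rw [hx']) hX, ?_, by linarith, .inl ⟨by rw [hx'], hX⟩⟩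
    rcases hb with hb | hb <;> linarith
  · push Not at hX
    have hm : max C x' < B - β := max_lt (by linarith) (by linarith)
    have hm1 := le_max_left C x'
    have hm2 := le_max_right C x'
    refine ⟨(max C x' + (B - β)) / 2 - x', by linarith, .mid hX (by linarith) (by linarith)
      (by linarith), by linarith, by linarith, .inr ⟨hX, by linarith⟩⟩

theorem StretchInv.reaches {β B : ℝ} (h : StretchInv C T β B i x' y') (hβ : 0 ≤ β)
    (hβB : β + C < B) (hB : B ≤ Ξ) {k : ℕ} (hik : i ≤ k)
    (hph : ∀ l, i ≤ l → l < k → ¬ T.rx l ∧ ¬ T.ry l ∧ C < T.y l + T.δ l ∧ T.y l + T.δ l < μ) :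
    ∃ x'' y'', Relation.ReflTransGen (Move C μ Ξ T) (T.q i, x', y') (T.q k, x'', y'') ∧
      y'' < B := by
  suffices ∃ x'' y'', Relation.ReflTransGen (Move C μ Ξ T) (T.q i, x', y') (T.q k, x'', y'') ∧
      StretchInv C T β B k x'' y'' by
    obtain ⟨a, b, h1, h2⟩ := this
    exact ⟨a, b, h1, h2.lt⟩
  induction k, hik using Nat.le_induction with
  | base => exact ⟨x', y', .refl, h⟩
  | succ k hik ih =>
    obtain ⟨a, b, h1, h2⟩ := ih fun l hl1 hl2 => hph l hl1 (by omega)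
    obtain ⟨p1, p2, p3, p4⟩ := hph k hik (by omega)
    obtain ⟨a', b', h3, h4⟩ := h2.move hβ hβB hB p1 p2 p3 p4
    exact ⟨a', b', h1.tail h3, h4⟩

/-- Between two consecutive resets of `x` the imitating run needs at most the time `C` (up to an
arbitrarily small amount), however long the trace takes. -/
theorem reaches_next_reset (hC : 0 ≤ C) {j k : ℕ} {b : ℝ} (hjk : j < k) (hrx : T.rx j)
    (hph : ∀ l, j ≤ l → l < k → ¬ T.ry l ∧ C < T.y l + T.δ l ∧ T.y l + T.δ l < μ)
    (hno : ∀ l, j < l → l < k → ¬ T.rx l) (hyb : y' < b) (hCb : C < b) (hb : b + C ≤ Ξ) :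
    ∃ x'' y'', Relation.ReflTransGen (Move C μ Ξ T) (T.q j, x', y') (T.q k, x'', y'') ∧
      y'' < b + C := by
  obtain ⟨h1, h2, h3⟩ := hph j le_rfl hjk
  have hm : max C y' < b := max_lt hCb hyb
  have hm1 := le_max_left C y'
  have hm2 := le_max_right C y'
  set β := (max C y' + b) / 2 with hβ
  have hmove : Move C μ Ξ T (T.q j, x', y') (T.q (j + 1), 0, β) := by
    refine ⟨j, β - y', by linarith, rfl, rfl, by simp, by simp [hrx], by simp [h1], fun _ => ?_⟩
    exact ⟨.mid h2 h3 (by simp only; linarith) (by simp only; linarith), by simp⟩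
  have hx1 := T.x_reset j hrx
  have hy1 := T.y_keep j h1
  have hinv : StretchInv C T β (b + C) (j + 1) 0 β :=
    ⟨by linarith, .inl ⟨hx1.symm, by linarith⟩, by simp, .inl (by linarith), by linarith⟩
  obtain ⟨a, c, h4, h5⟩ := hinv.reaches (μ := μ) (Ξ := Ξ) (by linarith) (by linarith) hb hjk
    fun l hl1 hl2 => ⟨hno l hl1 hl2, hph l (by omega) hl2⟩
  exact ⟨a, c, h4.head hmove, h5⟩

/-- The pigeonhole step. While `y` stays between `C` and the parameter, the source `T.q k` of any
later reset of `x` can be reached within the time `n * C`, if the resets in between have at most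
`n + 1` source states: a run that resets `x` twice from the same state may cut the loop. -/
theorem reaches_reset_source (hC : 0 ≤ C) (n : ℕ) : ∀ (V : Finset Q), V.card ≤ n + 1 →
    ∀ {j k : ℕ} {b x' y' : ℝ}, j ≤ k → T.rx j → T.rx k →
    (∀ l, j ≤ l → l ≤ k → ¬ T.ry l ∧ C < T.y l + T.δ l ∧ T.y l + T.δ l < μ) →
    (∀ l, j ≤ l → l ≤ k → T.rx l → T.q l ∈ V) → y' < b → C < b → b + n * C ≤ Ξ →
    ∃ x'' y'', Relation.ReflTransGen (Move C μ Ξ T) (T.q j, x', y') (T.q k, x'', y'') ∧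
      y'' < b + n * C := by
  classical
  induction n with
  | zero =>
    intro V hV j k b x' y' hjk hj hk hph hsrc hyb hCb hb
    have := Finset.card_le_one.1 (by simpa using hV) _ (hsrc j le_rfl hjk hj) _
      (hsrc k hjk le_rfl hk)
    exact ⟨x', y', by rw [this], by simpa using hyb⟩
  | succ n ih =>
    intro V hV j k b x' y' hjk hj hk hph hsrc hyb hCb hb
    push_cast at hb ⊢
    have hnC : 0 ≤ (n : ℝ) * C := by positivity
    -- the last reset of `x` from the state `T.q j`
    set P : ℕ → Prop := fun l => j ≤ l ∧ T.rx l ∧ T.q l = T.q j with hP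
    obtain ⟨hm1, hm2, hm3⟩ : P (Nat.findGreatest P k) :=
      Nat.findGreatest_spec hjk ⟨le_rfl, hj, rfl⟩
    have hmk : Nat.findGreatest P k ≤ k := Nat.findGreatest_le k
    have hlast : ∀ l, Nat.findGreatest P k < l → l ≤ k → ¬ P l :=
      fun l => Nat.findGreatest_is_greatest
    generalize Nat.findGreatest P k = m at hm1 hm2 hm3 hmk hlast
    rcases hmk.eq_or_lt with rfl | hmk
    · exact ⟨x', y', by rw [hm3], by nlinarith⟩
    have hex : ∃ l, m < l ∧ T.rx l := ⟨k, hmk, hk⟩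
    obtain ⟨hl1, hl2⟩ := Nat.find_spec hex
    have hlk : Nat.find hex ≤ k := Nat.find_min' hex ⟨hmk, hk⟩
    have hmin : ∀ l, m < l → l < Nat.find hex → ¬ T.rx l :=
      fun l h1 h2 h3 => Nat.find_min hex h2 ⟨h1, h3⟩
    generalize Nat.find hex = l at hl1 hl2 hlk hmin
    obtain ⟨a, c, h1, h2⟩ := reaches_next_reset (Ξ := Ξ) (x' := x') hC hl1 hm2
      (fun l' h h' => hph l' (by omega) (by omega)) hmin hyb hCb (by linarith)
    have hmem := hsrc j le_rfl hjk hj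
    obtain ⟨a', c', h3, h4⟩ := ih (V.erase (T.q j))
      (by rw [Finset.card_erase_of_mem hmem]; omega) (x' := a) hlk hl2 hk
      (fun l' h h' => hph l' (by omega) h')
      (fun l' h h' hr => Finset.mem_erase.2
        ⟨fun he => hlast l' (by omega) h' ⟨by omega, hr, he⟩, hsrc l' (by omega) h' hr⟩)
      h2 (by linarith) (by linarith)
    exact ⟨a', c', by rw [← hm3]; exact h1.trans h3, by linarith⟩

theorem Reaches.of_reflTransGen {c c' : Q × ℝ × ℝ} (h : Relation.ReflTransGen (Move C μ Ξ T) c c')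
    (h' : Reaches C μ Ξ T c') : Reaches C μ Ξ T c := by
  obtain ⟨j, a, b, h1, h2⟩ := h'
  exact ⟨j, a, b, .trans_right h h1, h2⟩

/-- At a reset of `x` with `y` between `C` and the parameter, the imitating run can go to a suitable
later reset of this kind: one where `y` is close to `μ`, or the last one, or (if there are
infinitely many) one after which `y` hardly grows. -/
theorem reaches_of_reset_mid (hC : 0 ≤ C) (hΞ : 1 + 2 * C < Ξ) {n : ℕ} {b : ℝ} (V : Finset Q)
    (hV : V.card ≤ n + 1) (hrx : T.rx i) (hry : ¬ T.ry i) (hCy : C < T.y i + T.δ i)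
    (hyμ : T.y i + T.δ i < μ) (hsrc : ∀ k, i ≤ k → Stays μ T i k → T.rx k → T.q k ∈ V)
    (hyb : y' < b) (hCb : C < b) (hb : b + n * C + (C + 1 / 4) ≤ Ξ) :
    Reaches C μ Ξ T (T.q i, x', y') := by
  have key : ∀ k, i ≤ k → Stays μ T i k → T.rx k → ∀ z, Ξ - (C + 1 / 4) ≤ z → z < Ξ →
      Relation.TransGen (Move C μ Ξ T) (T.q i, x', y') (T.q (k + 1), 0, z) := by
    intro k hik hst hk z hz hzΞ
    have hph : ∀ l, i ≤ l → l ≤ k → ¬ T.ry l ∧ C < T.y l + T.δ l ∧ T.y l + T.δ l < μ := by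
      intro l hl hlk
      have h := Stays.y_add_le (fun j hj hjl => hst j hj (hjl.trans hlk)) hl
      exact ⟨(hst l hl hlk).1, by linarith, (hst l hl hlk).2⟩
    obtain ⟨a, c, h1, h2⟩ := reaches_reset_source (Ξ := Ξ) (x' := x') hC n V hV hik hrx hk hph
      (fun l hl hlk => hsrc l hl fun j hj hjl => hst j hj (hjl.trans hlk)) hyb hCb (by linarith)
    obtain ⟨p1, p2, p3⟩ := hph k hik le_rfl
    refine .tail' h1 ⟨k, z - c, by linarith, rfl, rfl, by simp, by simp [hk], by simp [p1],
      fun _ => ⟨.mid p2 p3 (by simp only; linarith) (by simp only; linarith), by simp⟩⟩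
  have hyk : ∀ k, i ≤ k → Stays μ T i k → C < T.y (k + 1) ∧ T.y (k + 1) < μ := by
    intro k hik hst
    have h1 := T.y_keep k (hst k hik le_rfl).1
    have h2 := hst.y_add_le hik
    have h3 := (hst k hik le_rfl).2
    exact ⟨by linarith, by linarith⟩
  by_cases h1 : ∃ k, i ≤ k ∧ Stays μ T i k ∧ T.rx k ∧ μ - T.y (k + 1) ≤ C + 1 / 4
  · obtain ⟨k, hik, hst, hk, hle⟩ := h1
    obtain ⟨h2, h3⟩ := hyk k hik hst
    have hx := T.x_reset k hk
    exact ⟨k + 1, 0, Ξ - (μ - T.y (k + 1)), key k hik hst hk _ (by linarith) (by linarith),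
      .inl (.close (by linarith) h3 h2 (by linarith) (by linarith) (.inl ⟨hx.symm, by linarith⟩)
        (.inl (by ring)))⟩
  push Not at h1
  have h0 : Stays μ T i i := fun j hj hji => by
    obtain rfl := le_antisymm hj hji
    exact ⟨hry, hyμ⟩
  by_cases h2 : ∃ M, ∀ k, i ≤ k → Stays μ T i k → T.rx k → k ≤ M
  · obtain ⟨M, hM⟩ := h2
    classical
    set P : ℕ → Prop := fun k => i ≤ k ∧ Stays μ T i k ∧ T.rx k
    obtain ⟨hik, hst, hk⟩ : P (Nat.findGreatest P M) :=
      Nat.findGreatest_spec (hM i le_rfl h0 hrx) ⟨le_rfl, h0, hrx⟩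
    have hlast : ∀ l, Nat.findGreatest P M < l → l ≤ M → ¬ P l :=
      fun l => Nat.findGreatest_is_greatest
    generalize Nat.findGreatest P M = m at hik hst hk hlast
    obtain ⟨h3, h4⟩ := hyk m hik hst
    have h5 := h1 m hik hst hk
    have hx := T.x_reset m hk
    refine ⟨m + 1, 0, Ξ - (C + 1 / 4), key m hik hst hk _ le_rfl (by linarith),
      .inl (.close (by linarith) h4 h3 (by linarith) (by linarith) (.inl ⟨hx.symm, by linarith⟩)
        (.inr ⟨fun l hl hl2 hl3 => ?_, by linarith, by linarith⟩))⟩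
    have hst' : Stays μ T i l := fun j hj hjl => by
      rcases le_or_gt j m with h | h
      · exact hst j hj h
      · exact hl2 j h hjl
    exact hlast l (by omega) (hM l (by omega) hst' hl3) ⟨by omega, hst', hl3⟩
  · push Not at h2
    have hall : ∀ l, i ≤ l → ¬ T.ry l ∧ T.y l + T.δ l < μ := by
      intro l hl
      obtain ⟨k, _, hst, _, hk⟩ := h2 l
      exact hst l hl hk.le
    have hstay : ∀ k, Stays μ T i k := fun k j hj _ => hall j hj
    -- the values of `y` increase to a limit `s`, and the run jumps to a point just below it
    have hmono : Monotone fun k => T.y (i + k) := monotone_nat_of_le_succ fun k => by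
      have h3 := T.y_keep (i + k) (hall _ (by omega)).1
      have h4 := T.delay_pos (i + k)
      change T.y (i + k) ≤ T.y (i + k + 1)
      linarith
    have hbdd : BddAbove (Set.range fun k => T.y (i + k)) := ⟨μ, by
      rintro _ ⟨k, rfl⟩
      have h3 := (hall (i + k) (by omega)).2
      have h4 := T.delay_pos (i + k)
      simp only
      linarith⟩
    set s := ⨆ k, T.y (i + k)
    have hs : ∀ l, i ≤ l → T.y l ≤ s := fun l hl => by
      obtain ⟨k, rfl⟩ := Nat.exists_eq_add_of_le hl
      exact le_ciSup hbdd k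
    obtain ⟨N, hN⟩ := exists_lt_of_lt_ciSup (show s - (C + 1 / 4) < s by linarith)
    obtain ⟨k, hik, hst, hk, hkN⟩ := h2 (i + N)
    obtain ⟨e, rfl⟩ := Nat.exists_eq_add_of_le hik
    have h3 : T.y (i + N) ≤ T.y (i + e + 1) := hmono (show N ≤ e + 1 by omega)
    obtain ⟨h4, h5⟩ := hyk _ hik hst
    have hx := T.x_reset _ hk
    refine ⟨i + e + 1, 0, Ξ - (C + 1 / 4), key _ hik hst hk _ le_rfl (by linarith),
      .inl (.forever (fun l hl => ?_) hx.symm (by linarith) (by linarith) h4 (by linarith))⟩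
    obtain ⟨h6, h7⟩ := hall l (by omega)
    have h8 := hs l (by omega)
    exact ⟨h6, h7, by linarith⟩

section FiniteStates

variable [Fintype Q]

theorem one_add_two_mul_lt (hC : 0 ≤ C) (hΞ : 1 + C * (1 + (Fintype.card Q : ℝ)) < Ξ)
    (q : Q) : 1 + 2 * C < Ξ := by
  have h : (1 : ℝ) ≤ Fintype.card Q := by
    exact_mod_cast Fintype.card_pos_iff.2 ⟨q⟩
  nlinarith

/-- A jump for a reset of `x` with `y` between `C` and the parameter, from any imitating
configuration in which `y'` is not much larger than `C`. -/
theorem reaches_of_reset_early (hC : 0 ≤ C) (hΞ : 1 + C * (1 + (Fintype.card Q : ℝ)) < Ξ)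
    (hrx : T.rx i) (hry : ¬ T.ry i) (hCy : C < T.y i + T.δ i) (hyμ : T.y i + T.δ i < μ)
    (hy' : y' < C + 1 / 2) : Reaches C μ Ξ T (T.q i, x', y') := by
  have h1 := one_add_two_mul_lt hC hΞ (T.q i)
  obtain ⟨n, hn⟩ : ∃ n, Fintype.card Q = n + 1 :=
    Nat.exists_eq_succ_of_ne_zero (Fintype.card_pos_iff.2 ⟨T.q i⟩).ne'
  rw [hn] at hΞ
  push_cast at hΞ
  exact reaches_of_reset_mid (n := n) (b := C + 1 / 2) hC h1 Finset.univ (by simp [hn]) hrx hry hCy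
    hyμ (fun _ _ _ _ => Finset.mem_univ _) hy' (by linarith) (by linarith)

/-- When `y` leaves the range up to `C` ahead of `x`, and `x` will be reset before `y` is reset or
reaches the parameter, then `y'` may be up to `2 * C` at that reset. If the present state is the
source of such a reset, the imitating run goes there at once; otherwise there is one source
state less, which makes up for the additional delay. -/
theorem reaches_of_not_noReset (hC : 0 ≤ C) (hΞ : 1 + C * (1 + (Fintype.card Q : ℝ)) < Ξ)
    (hnr : ¬ NoReset μ T i) (hxy : T.x i ≤ T.y i) (hy : T.y i ≤ C) (hCy : C < T.y i + T.δ i) :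
    Reaches C μ Ξ T (T.q i, T.x i, T.y i) := by
  classical
  have hΞ' := one_add_two_mul_lt hC hΞ (T.q i)
  have hCphase : ∀ l, i ≤ l → Stays μ T i l → C < T.y l + T.δ l := fun l hl h => by
    have := h.y_add_le hl
    linarith
  by_cases hs : ∃ k, i ≤ k ∧ Stays μ T i k ∧ T.rx k ∧ T.q k = T.q i
  · obtain ⟨k, hik, hst, hk, hq⟩ := hs
    rw [← hq]
    exact reaches_of_reset_early hC hΞ hk (hst k hik le_rfl).1 (hCphase k hik hst)
      (hst k hik le_rfl).2 (by linarith)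
  push Not at hs
  have hex : ∃ k, i ≤ k ∧ Stays μ T i k ∧ T.rx k := by
    unfold NoReset at hnr
    push Not at hnr
    exact hnr
  obtain ⟨hik, hst, hk⟩ := Nat.find_spec hex
  have hmin : ∀ l, i ≤ l → l < Nat.find hex → Stays μ T i l → ¬ T.rx l :=
    fun l hl h1 h2 h3 => Nat.find_min hex h1 ⟨hl, h2, h3⟩
  generalize Nat.find hex = k at hik hst hk hmin
  have hst' : ∀ l, l ≤ k → Stays μ T i l := fun l hl j hj hjl => hst j hj (hjl.trans hl)
  have hinv : StretchInv C T (T.y i - T.x i) (2 * C + 3 / 4) i (T.x i) (T.y i) :=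
    ⟨hxy, .inl ⟨rfl, by linarith⟩, by ring, .inr rfl, by linarith⟩
  have hx0 := T.x_nonneg i
  obtain ⟨a, c, h1, h2⟩ := hinv.reaches (μ := μ) (Ξ := Ξ) (by linarith) (by linarith)
    (by linarith) hik fun l hl hlk => ⟨hmin l hl hlk (hst' l hlk.le), (hst l hl hlk.le).1,
      hCphase l hl (hst' l hlk.le), (hst l hl hlk.le).2⟩
  refine .of_reflTransGen h1 ?_
  have hcard : 2 ≤ Fintype.card Q :=
    Fintype.one_lt_card_iff.2 ⟨T.q k, T.q i, hs k hik hst hk⟩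
  obtain ⟨n, hn⟩ := Nat.exists_eq_add_of_le' hcard
  rw [hn] at hΞ
  push_cast at hΞ
  refine reaches_of_reset_mid (n := n) (b := 2 * C + 3 / 4) hC hΞ' (Finset.univ.erase (T.q i))
    ?_ hk (hst k hik le_rfl).1 (hCphase k hik hst) (hst k hik le_rfl).2 ?_ h2 (by linarith)
    (by linarith)
  · rw [Finset.card_erase_of_mem (Finset.mem_univ _), Finset.card_univ, hn]
    omega
  · intro l hl hl2 hl3
    refine Finset.mem_erase.2 ⟨hs l (by omega) (fun j hj hjl => ?_) hl3, Finset.mem_univ _⟩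
    rcases le_or_gt j k with h | h
    · exact hst j hj h
    · exact hl2 j h.le hjl

end FiniteStates

/-! ### The simulation -/

/-- If `y` has reached the parameter and `x` alone is reset, only `y` matters at this step. -/
theorem reaches_of_reset_x_of_high (hC : 0 ≤ C) (hrx : T.rx i) (hry : ¬ T.ry i)
    (hy : μ ≤ T.y i + T.δ i) (h : y' < Ξ ∨ μ < T.y i + T.δ i) :
    Reaches C μ Ξ T (T.q i, x', y') := by
  obtain ⟨d, hd, h1, h2⟩ := exists_delay_high (C := C) hy h
  have hx := T.x_reset i hrx
  have hys := T.y_keep i hry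
  exact reaches_of_reset_x hd hrx hry h2
    (.inl (.high (by rw [hys]; exact hy) h1 (.inl ⟨hx.symm, by linarith⟩)))

theorem reaches_of_reset_y_of_high (hC : 0 ≤ C) (hrx : ¬ T.rx i) (hry : T.ry i)
    (hx : μ ≤ T.x i + T.δ i) (h : x' < Ξ ∨ μ < T.x i + T.δ i) :
    Reaches C μ Ξ T (T.q i, x', y') :=
  .swap (reaches_of_reset_x_of_high (T := T.swap) hC hry hrx hx h)

/-- If `x` is copied exactly, stays at most `C`, and `y` is reset, then both clocks are at most
`C` and copied exactly. -/
theorem reaches_of_reset_y_of_low (hC : 0 ≤ C) (hrx : ¬ T.rx i) (hry : T.ry i)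
    (hx' : x' = T.x i) (hx : T.x i + T.δ i ≤ C) : Reaches C μ Ξ T (T.q i, x', y') := by
  have hxs := T.x_keep i hrx
  have hys := T.y_reset i hry
  subst hx'
  exact reaches_of_reset_y (T.delay_pos i) hrx hry (.low rfl hx)
    (.inl (.low hxs.symm (by linarith) hys.symm (by linarith)))

theorem reaches_of_forever (hC : 0 ≤ C) (hph : ∀ k, i ≤ k →
      ¬ T.ry k ∧ T.y k + T.δ k < μ ∧ y' + (T.y k - T.y i) < Ξ)
    (hx : x' = T.x i) (hle : T.x i ≤ T.y i) (hle' : T.x i ≤ y') (hy : C < T.y i) (hy' : C < y') :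
    Reaches C μ Ξ T (T.q i, x', y') := by
  subst hx
  have hδ := T.delay_pos i
  obtain ⟨h1, h2, h3⟩ := hph i le_rfl
  have hys := T.y_keep i h1
  have h4 := (hph (i + 1) (by omega)).2.2
  have hzy : SameZone C μ Ξ (T.y i + T.δ i) (y' + T.δ i) :=
    .mid (by linarith) h2 (by linarith) (by linarith)
  have hph' : ∀ k, i + 1 ≤ k →
      ¬ T.ry k ∧ T.y k + T.δ k < μ ∧ y' + T.δ i + (T.y k - T.y (i + 1)) < Ξ := fun k hk => by
    obtain ⟨p1, p2, p3⟩ := hph k (by omega)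
    exact ⟨p1, p2, by linarith⟩
  by_cases hrx : T.rx i
  · have hxs := T.x_reset i hrx
    exact reaches_of_reset_x hδ hrx h1 hzy (.inl (.forever hph' hxs.symm (by linarith)
      (by linarith) (by linarith) (by linarith)))
  · have hxs := T.x_keep i hrx
    refine reaches_of_not_reset hδ hrx h1 ?_ hzy (.inl (.forever hph' hxs.symm (by linarith)
      (by linarith) (by linarith) (by linarith)))
    rcases le_or_gt (T.x i + T.δ i) C with h | h
    · exact .low rfl h
    · exact .mid h (by linarith) h (by linarith)

variable [Fintype Q]

theorem reaches_of_reset_y_of_early (hC : 0 ≤ C)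
    (hΞ : 1 + C * (1 + (Fintype.card Q : ℝ)) < Ξ) (hrx : ¬ T.rx i) (hry : T.ry i)
    (hCx : C < T.x i + T.δ i) (hxμ : T.x i + T.δ i < μ) (hx' : x' < C + 1 / 2) :
    Reaches C μ Ξ T (T.q i, x', y') :=
  .swap (reaches_of_reset_early (T := T.swap) hC hΞ hry hrx hCx hxμ hx')

/-- A step that resets only `y`, where `x'` is either a copy of `x` or not much above `C`. -/
theorem reaches_of_reset_y_of_low_or_early (hC : 0 ≤ C)
    (hΞ : 1 + C * (1 + (Fintype.card Q : ℝ)) < Ξ) (hrx : ¬ T.rx i) (hry : T.ry i)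
    (hx' : x' < C + 1 / 2) (h : x' = T.x i ∨ C < T.x i) :
    Reaches C μ Ξ T (T.q i, x', y') := by
  have hΞ' := one_add_two_mul_lt hC hΞ (T.q i)
  have hδ := T.delay_pos i
  rcases le_or_gt (T.x i + T.δ i) C with h1 | h1
  · exact reaches_of_reset_y_of_low hC hrx hry (h.resolve_right (by linarith)) h1
  rcases lt_or_ge (T.x i + T.δ i) μ with h2 | h2
  · exact reaches_of_reset_y_of_early hC hΞ hrx hry h1 h2 hx'
  · exact reaches_of_reset_y_of_high hC hrx hry h2 (.inl (by linarith))

theorem reaches_of_low (hC : 0 ≤ C) (hμ : 2 * C < μ)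
    (hΞ : 1 + C * (1 + (Fintype.card Q : ℝ)) < Ξ) (hxy : T.x i ≤ T.y i) (hy : T.y i ≤ C) :
    Reaches C μ Ξ T (T.q i, T.x i, T.y i) := by
  have hΞ' := one_add_two_mul_lt hC hΞ (T.q i)
  have hδ := T.delay_pos i
  have hx0 := T.x_nonneg i
  by_cases hrx : T.rx i <;> by_cases hry : T.ry i
  · exact reaches_of_reset_both hC hrx hry
  · have hxs := T.x_reset i hrx
    have hys := T.y_keep i hry
    rcases le_or_gt (T.y i + T.δ i) C with h1 | h1
    · exact reaches_of_reset_x hδ hrx hry (.low rfl h1)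
        (.inl (.low hxs.symm (by linarith) hys.symm (by linarith)))
    rcases lt_or_ge (T.y i + T.δ i) μ with h2 | h2
    · exact reaches_of_reset_early hC hΞ hrx hry h1 h2 (by linarith)
    · exact reaches_of_reset_x_of_high hC hrx hry h2 (.inl (by linarith))
  · exact reaches_of_reset_y_of_low_or_early hC hΞ hrx hry (by linarith) (.inl rfl)
  have hxs := T.x_keep i hrx
  have hys := T.y_keep i hry
  rcases le_or_gt (T.y i + T.δ i) C with h1 | h1
  · exact reaches_of_not_reset hδ hrx hry (.low rfl (by linarith)) (.low rfl h1)
      (.inl (.low hxs.symm (by linarith) hys.symm (by linarith)))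
  rcases lt_or_ge (T.y i + T.δ i) μ with h2 | h2
  · by_cases hnr : NoReset μ T i
    · have hnr' := hnr.succ hry h2
      rcases le_or_gt (T.x i + T.δ i) C with h3 | h3
      · exact reaches_of_not_reset hδ hrx hry (.low rfl h3)
          (.mid h1 h2 h1 (by linarith)) (.inl (.linked (by linarith) (by linarith) (by linarith)
            (by linarith) (by linarith) (by linarith) (.inl ⟨hxs.symm, by linarith⟩) (.inl hnr')))
      · exact reaches_of_not_reset (d := C - T.x i + 1 / 4) (by linarith) hrx hry
          (.mid h3 (by linarith) (by linarith) (by linarith))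
          (.mid h1 h2 (by linarith) (by linarith))
          (.inl (.linked (by linarith) (by linarith) (by linarith)
            (by linarith) (by linarith) (by linarith)
            (.inr ⟨by linarith, by linarith, by linarith⟩) (.inl hnr')))
    · exact reaches_of_not_noReset hC hΞ hnr hxy hy h1
  -- `y` jumps to the parameter or beyond: keep the distances to the parameter
  have hzy : SameZone C μ Ξ (T.y i + T.δ i) (T.y i + (T.δ i + Ξ - μ)) :=
    sameZone_of_sub_eq (by ring) h1 (by linarith)
  have hzx : SameZone C μ Ξ (T.x i + T.δ i) (T.x i + (T.δ i + Ξ - μ)) :=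
    sameZone_of_sub_eq (by ring) (by linarith) (by linarith)
  refine reaches_of_not_reset (by linarith) hrx hry hzx hzy
    (.inl (.high (by linarith) (by linarith) (.inr (.inr ?_))))
  rcases lt_or_ge (T.x i + T.δ i) μ with h3 | h3
  · exact .inl ⟨by linarith, by linarith, by linarith, by linarith⟩
  · exact .inr ⟨by linarith, by linarith⟩

theorem reaches_of_close (hC : 0 ≤ C)
    (hΞ : 1 + C * (1 + (Fintype.card Q : ℝ)) < Ξ)
    (hxy : T.x i < T.y i) (hCy : C < T.y i) (hy' : y' < Ξ)
    (hsum : x' + (Ξ - y') ≤ C + 1 / 4)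
    (hx : x' = T.x i ∧ T.x i ≤ C ∨ C < T.x i ∧ C < x')
    (h : Ξ - y' = μ - T.y i ∨
        NoReset μ T i ∧ C < T.x i + (μ - T.y i) ∧ C < x' + (Ξ - y')) :
    Reaches C μ Ξ T (T.q i, x', y') := by
  have hΞ' := one_add_two_mul_lt hC hΞ (T.q i)
  have hδ := T.delay_pos i
  have hx0 := T.x_nonneg i
  have hx'0 : 0 ≤ x' := by rcases hx with hx | hx <;> linarith
  have hx'' : x' = T.x i ∨ C < T.x i := hx.imp And.left And.left
  by_cases hry : T.ry i
  · by_cases hrx : T.rx i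
    · exact reaches_of_reset_both hC hrx hry
    · exact reaches_of_reset_y_of_low_or_early hC hΞ hrx hry (by linarith) hx''
  have hys := T.y_keep i hry
  by_cases hrx : T.rx i
  · have hxs := T.x_reset i hrx
    rcases lt_or_ge (T.y i + T.δ i) μ with h1 | h1
    · rcases h with h | ⟨h, -⟩
      · exact reaches_of_reset_x hδ hrx hry (.mid (by linarith) h1 (by linarith) (by linarith))
          (.inl (.close (by linarith) (by linarith) (by linarith) (by linarith) (by linarith)
            (.inl ⟨hxs.symm, by linarith⟩) (.inl (by linarith))))
      · exact absurd hrx (h.not_rx hry h1)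
    · exact reaches_of_reset_x_of_high hC hrx hry h1 (.inl hy')
  have hxs := T.x_keep i hrx
  rcases le_or_gt (T.x i + T.δ i) C with h1 | h1
  · -- `x` stays at most `C`, and both runs proceed by the same delay
    have hx1 : x' = T.x i := hx''.resolve_right (by linarith)
    have hzx : SameZone C μ Ξ (T.x i + T.δ i) (x' + T.δ i) := .low (by rw [hx1]) h1
    rcases lt_or_ge (T.y i + T.δ i) μ with h2 | h2
    · have hyΞ : y' + T.δ i < Ξ := by rcases h with h | ⟨-, -, h⟩ <;> linarith
      refine reaches_of_not_reset hδ hrx hry hzx (.mid (by linarith) h2 (by linarith) hyΞ)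
        (.inl (.close (by linarith) (by linarith) (by linarith) hyΞ (by linarith)
          (.inl ⟨by linarith, by linarith⟩) ?_))
      exact h.imp (fun h => by linarith)
        fun h => ⟨h.1.succ hry h2, by linarith, by linarith⟩
    · have h3 : Ξ - y' = μ - T.y i := h.resolve_right fun h => by linarith
      exact reaches_of_not_reset hδ hrx hry hzx
        (sameZone_of_sub_eq (by linarith) (by linarith) (by linarith))
        (.inl (.high (by linarith) (by linarith) (.inl ⟨by linarith, by linarith⟩)))
  rcases lt_or_ge (T.y i + T.δ i) μ with h2 | h2
  · rcases h with h | ⟨hnr, h3, h4⟩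
    · have hCx' : C < x' + T.δ i := by rcases hx with hx | hx <;> linarith
      exact reaches_of_not_reset hδ hrx hry (.mid h1 (by linarith) hCx' (by linarith))
        (.mid (by linarith) h2 (by linarith) (by linarith))
        (.inl (.close (by linarith) (by linarith) (by linarith) (by linarith) (by linarith)
          (.inr ⟨by linarith, hCx'⟩) (.inl (by linarith))))
    · have hm : max (C - x') 0 < Ξ - y' := max_lt (by linarith) (by linarith)
      have hm1 := le_max_left (C - x') 0
      have hm2 := le_max_right (C - x') 0
      exact reaches_of_not_reset (d := (max (C - x') 0 + (Ξ - y')) / 2) (by linarith) hrx hry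
        (.mid h1 (by linarith) (by linarith) (by linarith))
        (.mid (by linarith) h2 (by linarith) (by linarith))
        (.inl (.close (by linarith) (by linarith) (by linarith) (by linarith) (by linarith)
          (.inr ⟨by linarith, by linarith⟩)
          (.inr ⟨hnr.succ hry h2, by linarith, by linarith⟩)))
  rcases lt_or_ge (T.x i + T.δ i) μ with h3 | h3
  · -- `y` reaches the parameter first, when `x'` is still not much above `C`
    rcases h2.eq_or_lt with h4 | h4
    · have hCx' : C < x' + (Ξ - y') := by
        rcases h with h | ⟨-, -, h⟩
        · rcases hx with hx | hx <;> linarith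
        · exact h
      exact reaches_of_not_reset (d := Ξ - y') (by linarith) hrx hry
        (.mid h1 h3 hCx' (by linarith)) (.param h4.symm (by ring))
        (.inl (.high (by linarith) (by linarith)
          (.inr (.inl ⟨by linarith, by linarith, hCx', by linarith⟩))))
    · exact reaches_of_not_reset (d := C + 3 / 8 - x') (by linarith) hrx hry
        (.mid h1 h3 (by linarith) (by linarith)) (.high h4 (by linarith))
        (.inl (.high (by linarith) (by linarith)
          (.inr (.inl ⟨by linarith, by linarith, by linarith, by linarith⟩))))
  · obtain ⟨d, hd, h4, h5⟩ := exists_delay_high (C := C) h3 (.inl (show x' < Ξ by linarith))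
    exact reaches_of_not_reset hd hrx hry h5 (.high (by linarith) (by linarith))
      (.inl (.high (by linarith) (by linarith) (.inr (.inr (.inr ⟨by linarith, h4⟩)))))

theorem reaches_of_linked (hC : 0 ≤ C) (hμ : 2 * C < μ)
    (hΞ : 1 + C * (1 + (Fintype.card Q : ℝ)) < Ξ)
    (hxy : T.x i ≤ T.y i) (hCy : C < T.y i) (hy' : y' < Ξ)
    (hdiff : y' - x' = T.y i - T.x i) (hd : T.y i - T.x i ≤ C)
    (hx : x' = T.x i ∧ T.x i ≤ C ∨ C < T.x i ∧ C < x' ∧ x' < C + 1 / 2)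
    (h : NoReset μ T i ∨ y' < C + 1 / 2 ∧ C < T.x i) :
    Reaches C μ Ξ T (T.q i, x', y') := by
  have hΞ' := one_add_two_mul_lt hC hΞ (T.q i)
  have hδ := T.delay_pos i
  have hx0 := T.x_nonneg i
  have hx'e : x' < C + 1 / 2 := by rcases hx with hx | hx <;> linarith
  have hx'' : x' = T.x i ∨ C < T.x i := hx.imp And.left And.left
  have hCy' : C < y' := by rcases hx with hx | hx <;> linarith
  by_cases hry : T.ry i
  · by_cases hrx : T.rx i
    · exact reaches_of_reset_both hC hrx hry
    · exact reaches_of_reset_y_of_low_or_early hC hΞ hrx hry hx'e hx''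
  have hys := T.y_keep i hry
  by_cases hrx : T.rx i
  · rcases lt_or_ge (T.y i + T.δ i) μ with h1 | h1
    · rcases h with h | ⟨h, -⟩
      · exact absurd hrx (h.not_rx hry h1)
      · exact reaches_of_reset_early hC hΞ hrx hry (by linarith) h1 h
    · exact reaches_of_reset_x_of_high hC hrx hry h1 (.inl hy')
  have hxs := T.x_keep i hrx
  rcases lt_or_ge (T.y i + T.δ i) μ with h1 | h1
  · rcases le_or_gt (T.x i + T.δ i) C with h2 | h2
    · have hx1 : x' = T.x i := hx''.resolve_right (by linarith)
      have hnr := h.resolve_right fun h => by linarith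
      exact reaches_of_not_reset hδ hrx hry (.low (by rw [hx1]) h2)
        (.mid (by linarith) h1 (by linarith) (by linarith))
        (.inl (.linked (by linarith) (by linarith) (by linarith) (by linarith) (by linarith)
          (by linarith) (.inl ⟨by linarith, by linarith⟩) (.inl (hnr.succ hry h1))))
    · -- both clocks are free, and a small delay brings `x'` above `C` and keeps it small
      suffices ∃ d, 0 < d ∧ C < x' + d ∧ x' + d < C + 1 / 2 ∧ y' + d < Ξ ∧
          (NoReset μ T i ∨ y' + d < C + 1 / 2) by
        obtain ⟨d, hd0, h3, h4, h5, h6⟩ := this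
        exact reaches_of_not_reset hd0 hrx hry (.mid h2 (by linarith) h3 (by linarith))
          (.mid (by linarith) h1 (by linarith) h5)
          (.inl (.linked (by linarith) (by linarith) (by linarith) h5 (by linarith)
            (by linarith) (.inr ⟨by linarith, h3, h4⟩)
            (h6.imp (fun h => h.succ hry h1) fun h => ⟨h, by linarith⟩)))
      rcases h with h | ⟨h, h3⟩
      · rcases hx with hx | hx
        · exact ⟨C - x' + 1 / 4, by linarith, by linarith, by linarith, by linarith, .inl h⟩
        · have hm : 0 < min (C + 1 / 2 - x') (Ξ - y') := lt_min (by linarith) (by linarith)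
          have hm1 := min_le_left (C + 1 / 2 - x') (Ξ - y')
          have hm2 := min_le_right (C + 1 / 2 - x') (Ξ - y')
          exact ⟨min (C + 1 / 2 - x') (Ξ - y') / 2, by linarith, by linarith, by linarith,
            by linarith, .inl h⟩
      · have hx1 := hx.resolve_left fun h => by linarith
        exact ⟨(C + 1 / 2 - y') / 2, by linarith, by linarith, by linarith, by linarith,
          .inr (by linarith)⟩
  -- from here on, the clocks keep the same distances to the parameter
  refine reaches_of_not_reset (d := Ξ - μ + (T.x i + T.δ i) - x') (by linarith) hrx hry
    (sameZone_of_sub_eq (by ring) (by linarith) (by linarith))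
    (sameZone_of_sub_eq (by linarith) (by linarith) (by linarith))
    (.inl (.high (by linarith) (by linarith) (.inr (.inr ?_))))
  rcases lt_or_ge (T.x i + T.δ i) μ with h3 | h3
  · exact .inl ⟨by linarith, by linarith, by linarith, by linarith⟩
  · exact .inr ⟨by linarith, by linarith⟩

theorem reaches_of_high (hC : 0 ≤ C)
    (hΞ : 1 + C * (1 + (Fintype.card Q : ℝ)) < Ξ) (hy : μ ≤ T.y i) (hy' : Ξ ≤ y')
    (hx : x' = T.x i ∧ T.x i ≤ C ∨ C < T.x i ∧ T.x i < μ ∧ C < x' ∧ x' < C + 1 / 2 ∨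
        C < T.x i ∧ T.x i < μ ∧ Ξ - x' = μ - T.x i ∧ μ - T.x i ≤ C + 1 / 4 ∨
        μ ≤ T.x i ∧ Ξ ≤ x') :
    Reaches C μ Ξ T (T.q i, x', y') := by
  have hΞ' := one_add_two_mul_lt hC hΞ (T.q i)
  have hδ := T.delay_pos i
  have hx0 := T.x_nonneg i
  have hzy : ∀ d, 0 < d → SameZone C μ Ξ (T.y i + T.δ i) (y' + d) :=
    fun d hd => .high (by linarith) (by linarith)
  by_cases hrx : T.rx i
  · by_cases hry : T.ry i
    · exact reaches_of_reset_both hC hrx hry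
    · exact reaches_of_reset_x_of_high hC hrx hry (by linarith) (.inr (by linarith))
  have hxs := T.x_keep i hrx
  rcases lt_or_ge (T.x i + T.δ i) μ with h1 | h1
  · by_cases hry : T.ry i
    · have hys := T.y_reset i hry
      rcases hx with hx | hx | hx | hx
      · exact reaches_of_reset_y_of_low_or_early hC hΞ hrx hry (by linarith) (.inl hx.1)
      · exact reaches_of_reset_y_of_low_or_early hC hΞ hrx hry hx.2.2.2 (.inr hx.1)
      · exact reaches_of_reset_y hδ hrx hry (sameZone_of_sub_eq (by linarith) (by linarith)
          (by linarith)) (.inr (.close (T := T.swap) (show T.y (i + 1) < T.x (i + 1) by linarith)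
            (show T.x (i + 1) < μ by linarith) (show C < T.x (i + 1) by linarith) (by linarith)
            (by linarith) (.inl ⟨hys.symm, show T.y (i + 1) ≤ C by linarith⟩)
            (.inl (show Ξ - (x' + T.δ i) = μ - T.x (i + 1) by linarith))))
      · linarith
    · have hys := T.y_keep i hry
      suffices ∃ d, 0 < d ∧ SameZone C μ Ξ (T.x i + T.δ i) (x' + d) ∧
          (x' + d = T.x (i + 1) ∧ T.x (i + 1) ≤ C ∨
            C < T.x (i + 1) ∧ T.x (i + 1) < μ ∧ C < x' + d ∧ x' + d < C + 1 / 2 ∨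
            C < T.x (i + 1) ∧ T.x (i + 1) < μ ∧ Ξ - (x' + d) = μ - T.x (i + 1) ∧
              μ - T.x (i + 1) ≤ C + 1 / 4 ∨
            μ ≤ T.x (i + 1) ∧ Ξ ≤ x' + d) by
        obtain ⟨d, hd, h2, h3⟩ := this
        exact reaches_of_not_reset hd hrx hry h2 (hzy d hd)
          (.inl (.high (by linarith) (by linarith) h3))
      rcases hx with hx | hx | hx | hx
      · rcases le_or_gt (T.x i + T.δ i) C with h2 | h2
        · exact ⟨T.δ i, hδ, .low (by rw [hx.1]) h2, .inl ⟨by linarith, by linarith⟩⟩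
        · exact ⟨C - x' + 1 / 4, by linarith, .mid h2 h1 (by linarith) (by linarith),
            .inr (.inl ⟨by linarith, by linarith, by linarith, by linarith⟩)⟩
      · exact ⟨(C + 1 / 2 - x') / 2, by linarith, .mid (by linarith) h1 (by linarith)
          (by linarith), .inr (.inl ⟨by linarith, by linarith, by linarith, by linarith⟩)⟩
      · exact ⟨T.δ i, hδ, sameZone_of_sub_eq (by linarith) (by linarith) (by linarith),
          .inr (.inr (.inl ⟨by linarith, by linarith, by linarith, by linarith⟩))⟩
      · linarith
  · have hx' : x' < Ξ ∨ μ < T.x i + T.δ i := by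
      rcases hx with hx | hx | hx | hx
      · exact .inl (by linarith)
      · exact .inl (by linarith)
      · exact .inl (by linarith)
      · exact .inr (by linarith)
    by_cases hry : T.ry i
    · exact reaches_of_reset_y_of_high hC hrx hry h1 hx'
    · have hys := T.y_keep i hry
      obtain ⟨d, hd, h2, h3⟩ := exists_delay_high (C := C) h1 hx'
      exact reaches_of_not_reset hd hrx hry h3 (hzy d hd)
        (.inl (.high (by linarith) (by linarith) (.inr (.inr (.inr ⟨by linarith, h2⟩)))))

theorem Rel.reaches (h : Rel C μ Ξ T i x' y') (hC : 0 ≤ C) (hμ : 2 * C < μ)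
    (hΞ : 1 + C * (1 + (Fintype.card Q : ℝ)) < Ξ) : Reaches C μ Ξ T (T.q i, x', y') := by
  cases h with
  | low h1 h2 h3 h4 =>
    subst h1 h3
    rcases le_total (T.x i) (T.y i) with h | h
    · exact reaches_of_low hC hμ hΞ h h4
    · exact .swap (reaches_of_low (T := T.swap) hC hμ hΞ h h2)
  | close h1 h2 h3 h4 h5 h6 h7 => exact reaches_of_close hC hΞ h1 h3 h4 h5 h6 h7
  | linked h1 h2 h3 h4 h5 h6 h7 h8 => exact reaches_of_linked hC hμ hΞ h1 h3 h4 h5 h6 h7 h8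
  | high h1 h2 h3 => exact reaches_of_high hC hΞ h1 h2 h3
  | forever h1 h2 h3 h4 h5 h6 => exact reaches_of_forever hC h1 h2 h3 h4 h5 h6

/-- A trace whose clocks start at values up to `C` is imitated, for the parameter value `Ξ`, by an
infinite sequence of moves from the same configuration. -/
theorem exists_infinite_moves (hC : 0 ≤ C) (hμ : 2 * C < μ)
    (hΞ : 1 + C * (1 + (Fintype.card Q : ℝ)) < Ξ) (hx : T.x 0 ≤ C) (hy : T.y 0 ≤ C) :
    ∃ c : ℕ → Q × ℝ × ℝ, c 0 = (T.q 0, T.x 0, T.y 0) ∧ ∀ n, Move C μ Ξ T (c n) (c (n + 1)) := by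
  let S : Set (Q × ℝ × ℝ) := {c | Reaches C μ Ξ T c}
  have hS : ∀ c : S, ∃ c' : S, Move C μ Ξ T c c' := by
    rintro ⟨c, j, a, b, h1, h2⟩
    have h3 : Reaches C μ Ξ T (T.q j, a, b) := by
      rcases h2 with h2 | h2
      · exact h2.reaches hC hμ hΞ
      · exact .swap (h2.reaches hC hμ hΞ)
    obtain ⟨c', h4, h5⟩ := Relation.TransGen.head'_iff.1 h1
    exact ⟨⟨c', h3.of_reflTransGen h5⟩, h4⟩
  choose f hf using hS
  have h0 : Reaches C μ Ξ T (T.q 0, T.x 0, T.y 0) :=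
    Rel.reaches (.low rfl hx rfl hy) hC hμ hΞ
  refine ⟨fun n => (f^[n] ⟨_, h0⟩ : S), rfl, fun n => ?_⟩
  simp only [Function.iterate_succ_apply']
  exact hf _

end TwoClockTrace

/-! ### From automata to traces and back -/

theorem SameZone.sat_iff {X P : Type*} {M : ℕ} {μ Ξ : ℝ} (hμ : (M : ℝ) < μ) (hΞ : (M : ℝ) < Ξ)
    {v v' : X → ℝ} (g : Guard X P) (hg : g.maxConst ≤ M)
    (h : ∀ z ∈ g.clocks, SameZone M μ Ξ (v z) (v' z)) :
    g.Sat (fun _ => μ) v ↔ g.Sat (fun _ => Ξ) v' := by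
  induction g with
  | tt => exact Iff.rfl
  | ltConst x c =>
    have hc : (c : ℝ) ≤ M := by exact_mod_cast hg
    have hx := h x rfl
    simp only [Guard.Sat]
    rcases hx with ⟨h1, h2⟩ | ⟨h1, h2, h3, h4⟩ | ⟨h1, h2⟩ | ⟨h1, h2⟩ <;>
      constructor <;> intro h5 <;> linarith
  | eqConst x c =>
    have hc : (c : ℝ) ≤ M := by exact_mod_cast hg
    have hx := h x rfl
    simp only [Guard.Sat]
    rcases hx with ⟨h1, h2⟩ | ⟨h1, h2, h3, h4⟩ | ⟨h1, h2⟩ | ⟨h1, h2⟩ <;>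
      constructor <;> intro h5 <;> linarith
  | ltParam x p =>
    have hx := h x rfl
    simp only [Guard.Sat]
    rcases hx with ⟨h1, h2⟩ | ⟨h1, h2, h3, h4⟩ | ⟨h1, h2⟩ | ⟨h1, h2⟩ <;>
      constructor <;> intro h5 <;> linarith
  | eqParam x p =>
    have hx := h x rfl
    simp only [Guard.Sat]
    rcases hx with ⟨h1, h2⟩ | ⟨h1, h2, h3, h4⟩ | ⟨h1, h2⟩ | ⟨h1, h2⟩ <;>
      constructor <;> intro h5 <;> linarith
  | neg g ih => exact not_congr (ih hg h)
  | conj g k ihg ihk =>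
    obtain ⟨h1, h2⟩ := max_le_iff.1 hg
    exact and_congr (ihg h1 fun z hz => h z (.inl hz)) (ihk h2 fun z hz => h z (.inr hz))

/-- `t.Step I d v v'`: after the delay `d`, the valuation `v` satisfies the guard of `t`, and the
resets of `t` then lead to `v'`. -/
structure Transition.Step {S Q X P : Type*} (t : Transition S Q X P) (I : P → ℝ) (d : ℝ)
    (v v' : X → ℝ) : Prop where
  sat : t.guard.Sat I fun x => v x + d
  reset : ∀ x ∈ t.resets, v' x = 0
  keep : ∀ x, x ∉ t.resets → v' x = v x + d

namespace ParamTA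

variable {S Q X P : Type*} {A : ParamTA S Q X P}

theorem hasRun_of_steps {I : P → ℝ} {t : ℕ → Transition S Q X P} {d : ℕ → ℝ} {q : ℕ → Q}
    {v : ℕ → X → ℝ} (hq : q 0 = A.init) (hv : ∀ x, v 0 x = 0) (hd0 : 0 ≤ d 0)
    (hd : ∀ n, 0 < d (n + 1))
    (h : ∀ n, t n ∈ A.trans ∧ (t n).src = q n ∧ (t n).tgt = q (n + 1) ∧
      (t n).Step I (d n) (v n) (v (n + 1))) : A.HasRun I := by
  -- position `n + 1` carries the letter of `t n`; the value at position `0` is arbitrary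
  refine ⟨⟨fun n => (t (n - 1)).letter, fun n => ∑ i ∈ Finset.range n, d i, by simp,
    by simpa using hd0, fun i hi => ?_⟩, q, v, hq, hv, fun i => ?_⟩
  · obtain ⟨k, rfl⟩ := Nat.exists_eq_add_of_le' hi
    simp only [Finset.sum_range_succ _ (k + 1)]
    linarith [hd k]
  · obtain ⟨h1, h2, h3, h4⟩ := h i
    refine ⟨t i, h1, h2, h3, rfl, ?_⟩
    simp only [Finset.sum_range_succ, add_sub_cancel_left]
    exact ⟨h4.sat, h4.reset, h4.keep⟩

/-- An infinite sequence of steps with positive delays for the parameter value `μ` that starts from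
a valuation up to the largest constant can be replaced by one for the parameter value `Ξ` that
starts from the same state and valuation. -/
theorem exists_steps [Finite Q] {μ Ξ : ℝ} (hA : A.IsNonResettingTest) {a b : X} (hab : a ≠ b)
    (huniv : ∀ z, z = a ∨ z = b) (hμ : 2 * (A.maxConst : ℝ) < μ)
    (hΞ : 1 + (A.maxConst : ℝ) * (1 + (Nat.card Q : ℝ)) < Ξ)
    {t : ℕ → Transition S Q X P} {d : ℕ → ℝ} {q : ℕ → Q} {v : ℕ → X → ℝ} (hd : ∀ n, 0 < d n)
    (hv0 : ∀ x, 0 ≤ v 0 x) (hvC : ∀ x, v 0 x ≤ A.maxConst)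
    (h : ∀ n, t n ∈ A.trans ∧ (t n).src = q n ∧ (t n).tgt = q (n + 1) ∧
      (t n).Step (fun _ => μ) (d n) (v n) (v (n + 1))) :
    ∃ (t' : ℕ → Transition S Q X P) (d' : ℕ → ℝ) (q' : ℕ → Q) (v' : ℕ → X → ℝ),
      (∀ n, 0 < d' n) ∧ q' 0 = q 0 ∧ v' 0 = v 0 ∧
      ∀ n, t' n ∈ A.trans ∧ (t' n).src = q' n ∧ (t' n).tgt = q' (n + 1) ∧
        (t' n).Step (fun _ => Ξ) (d' n) (v' n) (v' (n + 1)) := by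
  classical
  have := Fintype.ofFinite Q
  rw [Nat.card_eq_fintype_card] at hΞ
  have hC : (0 : ℝ) ≤ A.maxConst := Nat.cast_nonneg _
  have hΞ' := TwoClockTrace.one_add_two_mul_lt hC hΞ (q 0)
  have hnonneg : ∀ n x, 0 ≤ v n x := by
    intro n
    induction n with
    | zero => exact hv0
    | succ n ih =>
      intro x
      by_cases hx : x ∈ (t n).resets
      · exact ((h n).2.2.2.reset x hx).ge
      · rw [(h n).2.2.2.keep x hx]
        exact add_nonneg (ih x) (hd n).le
  let T : TwoClockTrace Q :=
    { q := q
      x := fun n => v n a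
      y := fun n => v n b
      δ := d
      rx := fun n => a ∈ (t n).resets
      ry := fun n => b ∈ (t n).resets
      delay_pos := hd
      x_nonneg := fun n => hnonneg n a
      y_nonneg := fun n => hnonneg n b
      x_reset := fun n => (h n).2.2.2.reset a
      x_keep := fun n => (h n).2.2.2.keep a
      y_reset := fun n => (h n).2.2.2.reset b
      y_keep := fun n => (h n).2.2.2.keep b }
  obtain ⟨c, hc0, hc⟩ := TwoClockTrace.exists_infinite_moves (T := T) hC hμ hΞ (hvC a) (hvC b)
  choose k e he h1 h2 h3 h4 h5 h6 using hc
  let w : ℕ → X → ℝ := fun n z => if z = a then (c n).2.1 else (c n).2.2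
  have hwa : ∀ n, w n a = (c n).2.1 := fun n => if_pos rfl
  have hwb : ∀ n, w n b = (c n).2.2 := fun n => if_neg hab.symm
  refine ⟨fun n => t (k n), e, fun n => (c n).1, w, he, congrArg Prod.fst hc0, funext fun z => ?_,
    fun n => ⟨(h (k n)).1, ?_, ?_, ?_⟩⟩
  · rcases huniv z with rfl | rfl
    · rw [hwa, hc0]
    · rw [hwb, hc0]
  · exact (h (k n)).2.1.trans (h1 n).symm
  · exact (h (k n)).2.2.1.trans (h2 n).symm
  have hs := (h (k n)).2.2.2
  refine ⟨?_, fun z hz => ?_, fun z hz => ?_⟩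
  · refine (SameZone.sat_iff (M := A.maxConst) (by linarith) (by linarith) _
      (Finset.le_sup (f := fun t : Transition S Q X P => t.guard.maxConst) (h (k n)).1)
      fun z hz => ?_).1 hs.sat
    have hz' : z ∉ (t (k n)).resets := fun hr =>
      Set.eq_empty_iff_forall_notMem.1 (hA _ (h (k n)).1) z ⟨hz, hr⟩
    rcases huniv z with rfl | rfl
    · rw [hwa]
      exact (h4 n hz').1
    · rw [hwb]
      exact (h6 n hz').1
  · rcases huniv z with rfl | rfl
    · rw [hwa]
      exact h3 n hz
    · rw [hwb]
      exact h5 n hz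
  · rcases huniv z with rfl | rfl
    · rw [hwa, hwa]
      exact (h4 n hz).2
    · rw [hwb, hwb]
      exact (h6 n hz).2

/-- A first timestamp `0` gives the first step the delay `0`; all clocks are `0` after it, so the
simulation can start with the second step. -/
theorem HasRun.change_param [Finite Q] {μ Ξ : ℝ} (hX : Nat.card X = 2)
    (hA : A.IsNonResettingTest) (hμ : 2 * (A.maxConst : ℝ) < μ)
    (hΞ : 1 + (A.maxConst : ℝ) * (1 + (Nat.card Q : ℝ)) < Ξ) (h : A.HasRun fun _ => μ) :
    A.HasRun fun _ => Ξ := by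
  obtain ⟨a, b, hab, huniv⟩ := Nat.card_eq_two_iff.1 hX
  replace huniv : ∀ z, z = a ∨ z = b := fun z => by
    simpa using huniv.ge (Set.mem_univ z)
  obtain ⟨w, q, v, hq, hv, hstep⟩ := h
  choose t ht hsrc htgt _ hsat hreset hkeep using hstep
  have hC : (0 : ℝ) ≤ A.maxConst := Nat.cast_nonneg _
  have hs : ∀ n, t n ∈ A.trans ∧ (t n).src = q n ∧ (t n).tgt = q (n + 1) ∧
      (t n).Step (fun _ => μ) (w.time (n + 1) - w.time n) (v n) (v (n + 1)) :=
    fun n => ⟨ht n, hsrc n, htgt n, hsat n, hreset n, hkeep n⟩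
  have hpos : ∀ n, 0 < w.time (n + 1 + 1) - w.time (n + 1) :=
    fun n => sub_pos.2 (w.time_lt (n + 1) (by omega))
  have h1 := w.time_one_nonneg
  have h0 := w.time_zero
  rcases h1.eq_or_lt with h1 | h1
  · have hv1 : ∀ x, v 1 x = 0 := fun x => by
      by_cases hx : x ∈ (t 0).resets
      · exact hreset 0 x hx
      · rw [hkeep 0 x hx, hv, h0, zero_add, ← h1, sub_zero]
    obtain ⟨t', d', q', v', hd', hq', hv', hs'⟩ := exists_steps hA hab huniv hμ hΞ hpos
      (fun x => (hv1 x).ge) (fun x => by simp [hv1 x]) fun n => hs (n + 1)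
    have hnQ : 0 ≤ (A.maxConst : ℝ) * ((Nat.card Q : ℝ) - 1) := by
      have : Nonempty Q := ⟨q 0⟩
      have : (1 : ℝ) ≤ Nat.card Q := by exact_mod_cast Nat.card_pos (α := Q)
      exact mul_nonneg hC (by linarith)
    refine hasRun_of_steps (t := fun n => Nat.casesOn n (t 0) t')
      (d := fun n => Nat.casesOn n 0 d') (q := fun n => Nat.casesOn n (q 0) q')
      (v := fun n => Nat.casesOn n (v 0) v') hq hv le_rfl hd' fun n => ?_
    cases n with
    | zero =>
      refine ⟨ht 0, hsrc 0, (htgt 0).trans hq'.symm, ?_, fun x _ => ?_, fun x _ => ?_⟩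
      · refine (SameZone.sat_iff (M := A.maxConst) (by linarith) (by linarith) _
          (Finset.le_sup (f := fun t : Transition S Q X P => t.guard.maxConst) (ht 0))
          fun z _ => .low ?_ ?_).1 (hsat 0)
        · simp [h0, ← h1]
        · simp [h0, ← h1, hv z]
      · exact (congrFun hv' x).trans (hv1 x)
      · exact (congrFun hv' x).trans (by simp [hv1 x, hv x])
    | succ n => exact hs' n
  · obtain ⟨t', d', q', v', hd', hq', hv', hs'⟩ := exists_steps hA hab huniv hμ hΞ
      (d := fun n => w.time (n + 1) - w.time n)
      (fun n => by
        cases n with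
        | zero => simpa [h0] using h1
        | succ n => exact hpos n)
      (fun x => (hv x).ge) (fun x => by simp [hv x]) hs
    exact hasRun_of_steps (hq'.trans hq) (fun x => by rw [hv', hv x]) (hd' 0).le
      (fun n => hd' (n + 1)) hs'

end ParamTA

theorem mainTheorem2 {S Q X P : Type*} [Finite S] [Finite Q]
    (hX : Nat.card X = 2) (hP : Nat.card P = 1)
    (A : ParamTA S Q X P) (hA : A.IsNonResettingTest) :
    (∃ Ξ : ℝ, 2 * (A.maxConst : ℝ) < Ξ ∧
      ∀ μ : ℝ, 2 * (A.maxConst : ℝ) < μ →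
        A.HasRun (fun _ => μ) → A.HasRun (fun _ => Ξ)) ∧
    (∀ Ξ : ℝ, 1 + (A.maxConst : ℝ) * (1 + (Nat.card Q : ℝ)) < Ξ →
      2 * (A.maxConst : ℝ) < Ξ ∧
      ∀ μ : ℝ, 2 * (A.maxConst : ℝ) < μ →
        A.HasRun (fun _ => μ) → A.HasRun (fun _ => Ξ)) := by
  have key : ∀ Ξ : ℝ, 1 + (A.maxConst : ℝ) * (1 + (Nat.card Q : ℝ)) < Ξ →
      2 * (A.maxConst : ℝ) < Ξ ∧
      ∀ μ : ℝ, 2 * (A.maxConst : ℝ) < μ →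
        A.HasRun (fun _ => μ) → A.HasRun (fun _ => Ξ) := by
    refine fun Ξ hΞ => ⟨?_, fun μ hμ h => h.change_param hX hA hμ hΞ⟩
    have := Fintype.ofFinite Q
    rw [Nat.card_eq_fintype_card] at hΞ
    linarith [TwoClockTrace.one_add_two_mul_lt (Nat.cast_nonneg _) hΞ A.init]
  exact ⟨⟨_, key _ (lt_add_one _)⟩, key⟩
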